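/- **Setting.** A (finite) Bayesian game has players $1,\dots,n$; each player $i$ has a finite type set $\Theta_i$ and, for each type $\theta_i$, a finite non-empty action set $A_i^{\theta_i}$ (these sets are pairwise disjoint over all $i,\theta_i$). The type profile $\theta\in\Theta=\prod_i\Theta_i$ is drawn from a common prior $\rho\in\Delta(\Theta)$, called *independent* if it is a product distribution. Put $A_i=\bigcup_{\theta_i}A_i^{\theta_i}$, $A=\prod_iA_i$, $A^\theta=\prod_iA_i^{\theta_i}$, $E=\bigcup_iA_i$. There are utilities $v_i\colon A\to\mathbb R_{\ge0}$ and a social welfare $v_{\mathrm{SW}}\colon A\to\mathbb R_{\ge0}$. The game is a *Bayesian basic utility game* if there is a non-negative, monotone, submodular $f\colon2^E\to\mathbb R_{\ge0}$ such that for all $a\in A$ and all $i$: $v_{\mathrm{SW}}(a)=f(\{a_1,\dots,a_n\})$, $\sum_jv_j(a)\le v_{\mathrm{SW}}(a)$, and $v_i(a)=v_{\mathrm{SW}}(a)-f(\{a_j:j\ne i\})$. If each player has only one type it is called a basic utility game. A strategy of player $i$ is an $s_i\in S_i=\prod_{\theta_i}A_i^{\theta_i}$; $S=\prod_iS_i$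 and $s(\theta)=(s_1(\theta_1),\dots,s_n(\theta_n))$. The *strategic form* is the complete-information game with action sets $S_i$, utilities $\mathbb E_{\theta\sim\rho}[v_i(s(\theta))]$ and welfare $\mathbb E_{\theta\sim\rho}[v_{\mathrm{SW}}(s(\theta))]$. A distribution $\sigma\in\Delta(S)$ is a *strategic-form coarse correlated equilibrium* (SFCCE) if $\mathbb E_\theta\mathbb E_{s\sim\sigma}[v_i(s(\theta))]\ge\mathbb E_\theta\mathbb E_{s\sim\sigma}[v_i(s_i'(\theta_i),s_{-i}(\theta_{-i}))]$ for all $i$ and $s'_i\in S_i$; it is a *Bayes–Nash equilibrium* (BNE) if moreover $\sigma$ is a product distribution $\prod_i\sigma_i$ with $\sigma_i\in\Delta(S_i)$. Let $\mathrm{OPT}=\mathbb E_{\theta\sim\rho}[\max_{a\in A^\theta}v_{\mathrm{SW}}(a)]$. For a set $\Sigma\subseteq\Delta(S)$ of equilibria, the price of stability is $\mathrm{PoS}_\Sigma=\sup_{\sigma\in\Sigma}\mathbb E_\theta\mathbb E_{s\sim\sigma}[v_{\mathrm{SW}}(s(\theta))]/\mathrm{OPT}$, and the *strategy representability gap* is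 $\mathrm{SR}=\max_{s\in S}\mathbb E_\theta[v_{\mathrm{SW}}(s(\theta))]/\mathrm{OPT}$. All statements about these ratios concern games with $\mathrm{OPT}>0$. **Theorem.** 1. The strategic form of every Bayesian basic utility game is a basic utility game. 2. In every Bayesian basic utility game, (the point mass at) any strategy profile $s\in S$ that maximizes $\mathbb E_\theta[v_{\mathrm{SW}}(s(\theta))]$ is a BNE. 3. In every Bayesian basic utility game, $\mathrm{PoS}_{\mathrm{BNE}}\ge\mathrm{SR}$. 4. In every Bayesian basic utility game with an independent prior, $\mathrm{PoS}_{\mathrm{BNE}}\ge1-1/e$. 5. There is an absolute constant $c>0$ such that in every Bayesian basic utility game with $n\ge1$ players and arbitrary (possibly correlated) prior, $\mathrm{PoS}_{\mathrm{BNE}}\ge c/\sqrt n$. 6. In every Bayesian game, $\mathrm{PoS}_{\mathrm{BNE}}\le\mathrm{PoS}_{\mathrm{SFCCE}}\le\mathrm{SR}$. 7. (Tightness, independent case.) For every $\varepsilon>0$ there is a Bayesian basic utility game with an independent prior, with $\mathrm{OPT}>0$ and $\mathrm{PoS}_{\mathrm{SFCCE}}\le1-1/e+\varepsilon$. 8.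 (Tightness, correlated case.) There is an absolute constant $C>0$ such that for every $n\ge1$ there is a Bayesian basic utility game with $n$ players, with $\mathrm{OPT}>0$ and $\mathrm{PoS}_{\mathrm{SFCCE}}\le C/\sqrt n$. -/

import Mathlib

universe u v

/-- A finite Bayesian game with `n` players and type-dependent action sets.  The action sets
`Act i t` are distinct types, so they are disjoint over all players `i` and types `t`. -/
structure BayesianGame (n : ℕ) where
  /-- the finite set of types of each player -/
  Θ : Fin n → Type u
  [fintypeΘ : ∀ i, Fintype (Θ i)]
  [decEqΘ : ∀ i, DecidableEq (Θ i)]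
  /-- the finite nonempty set of actions available to player `i` with type `t` -/
  Act : ∀ i, Θ i → Type v
  [fintypeAct : ∀ i t, Fintype (Act i t)]
  [nonemptyAct : ∀ i t, Nonempty (Act i t)]
  /-- the common prior over type profiles -/
  ρ : (∀ i, Θ i) → ℝ
  ρ_mem : ρ ∈ stdSimplex ℝ (∀ i, Θ i)
  /-- the utility functions, defined on the product over `i` of the union of all action sets
  of player `i` -/
  v : Fin n → (∀ i, Σ t : Θ i, Act i t) → ℝ
  v_nonneg : ∀ i a, 0 ≤ v i a
  /-- the social welfare function -/
  SW : (∀ i, Σ t : Θ i, Act i t) → ℝ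
  SW_nonneg : ∀ a, 0 ≤ SW a

namespace BayesianGame

attribute [instance] fintypeΘ decEqΘ fintypeAct nonemptyAct

variable {n : ℕ} (G : BayesianGame.{u, v} n)

abbrev TypeProfile : Type u := ∀ i, G.Θ i

/-- All actions of player `i` (the disjoint union over the types of `i`). -/
abbrev Action (i : Fin n) : Type (max u v) := Σ t : G.Θ i, G.Act i t

abbrev ActionProfile : Type (max u v) := ∀ i, G.Action i

/-- The ground set: the disjoint union of all actions of all players. -/
abbrev Ground : Type (max u v) := Σ i : Fin n, G.Action i

/-- A strategy of player `i` picks an available action for every type of `i`. -/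
abbrev Strategy (i : Fin n) : Type (max u v) := ∀ t : G.Θ i, G.Act i t

abbrev StrategyProfile : Type (max u v) := ∀ i, G.Strategy i

/-- The action profile `s(θ)`. -/
def play (s : G.StrategyProfile) (θ : G.TypeProfile) : G.ActionProfile :=
  fun i => ⟨θ i, s i (θ i)⟩

/-- Expectation over the type profile drawn from the prior. -/
noncomputable def expect (g : G.TypeProfile → ℝ) : ℝ := ∑ θ, G.ρ θ * g θ

/-- The prior is a product distribution. -/
def IsIndependent : Prop :=
  ∃ μ : ∀ i, G.Θ i → ℝ, (∀ i, μ i ∈ stdSimplex ℝ (G.Θ i)) ∧ ∀ θ, G.ρ θ = ∏ i, μ i (θ i)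

/-- Submodularity (diminishing marginal returns) of a set function. -/
def IsSubmodular {E : Type*} (f : Set E → ℝ) : Prop :=
  ∀ X Y : Set E, X ⊆ Y → ∀ u, u ∉ Y → f (Y ∪ {u}) - f Y ≤ f (X ∪ {u}) - f X

/-- The set of actions chosen by the players in `P` under the action profile `a`. -/
def chosen (a : G.ActionProfile) (P : Set (Fin n)) : Set G.Ground :=
  (fun i => (⟨i, a i⟩ : G.Ground)) '' P

/-- Bayesian basic utility games: the social welfare is `f {a₁, …, aₙ}` for a non-negative
monotone submodular set function `f` on the ground set, the utilities sum up to at most the social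
welfare, and the utility of each player is their marginal contribution to the social welfare. A
(complete-information) basic utility game is the case in which every player has one type. -/
def IsBasicUtilityGame : Prop :=
  ∃ f : Set G.Ground → ℝ,
    (∀ X, 0 ≤ f X) ∧ Monotone f ∧ IsSubmodular f ∧
    (∀ a, G.SW a = f (G.chosen a Set.univ)) ∧
    (∀ a, ∑ i, G.v i a ≤ G.SW a) ∧
    (∀ a i, G.v i a = G.SW a - f (G.chosen a {i}ᶜ))

/-- The strategic form: the complete-information game in which each player has a single type,
the actions of a player are their strategies, and utilities and social welfare are the expected
ones. -/
noncomputable def strategicForm : BayesianGame.{u, max u v} n where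
  Θ := fun _ => PUnit
  Act := fun i _ => G.Strategy i
  ρ := fun _ => 1
  ρ_mem := ⟨fun _ => zero_le_one, by simp⟩
  v := fun i s => G.expect fun θ => G.v i (G.play (fun j => (s j).2) θ)
  v_nonneg := fun i _ =>
    Finset.sum_nonneg fun θ _ => mul_nonneg (G.ρ_mem.1 θ) (G.v_nonneg i _)
  SW := fun s => G.expect fun θ => G.SW (G.play (fun j => (s j).2) θ)
  SW_nonneg := fun _ =>
    Finset.sum_nonneg fun θ _ => mul_nonneg (G.ρ_mem.1 θ) (G.SW_nonneg _)

/-- Expected social welfare of a strategy profile. -/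
noncomputable def welfare (s : G.StrategyProfile) : ℝ := G.expect fun θ => G.SW (G.play s θ)

/-- Expected social welfare of a distribution over strategy profiles. -/
noncomputable def distWelfare (σ : G.StrategyProfile → ℝ) : ℝ :=
  G.expect fun θ => ∑ s, σ s * G.SW (G.play s θ)

/-- The optimal social welfare, where the action profile may depend on the whole type profile. -/
noncomputable def optWelfare : ℝ :=
  G.expect fun θ => ⨆ a : ∀ i, G.Act i (θ i), G.SW fun i => ⟨θ i, a i⟩

/-- Strategic-form coarse correlated equilibria, as a set of distributions over strategy
profiles. -/
def SFCCE : Set (G.StrategyProfile → ℝ) :=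
  {σ | σ ∈ stdSimplex ℝ G.StrategyProfile ∧
    ∀ (i : Fin n) (s' : G.Strategy i),
      (G.expect fun θ => ∑ s, σ s * G.v i (G.play (Function.update s i s') θ)) ≤
        G.expect fun θ => ∑ s, σ s * G.v i (G.play s θ)}

/-- Bayes–Nash equilibria: strategic-form coarse correlated equilibria in which the players'
strategies are stochastically independent. -/
def BNE : Set (G.StrategyProfile → ℝ) :=
  {σ | σ ∈ G.SFCCE ∧
    ∃ μ : ∀ i, G.Strategy i → ℝ,
      (∀ i, μ i ∈ stdSimplex ℝ (G.Strategy i)) ∧ ∀ s, σ s = ∏ i, μ i (s i)}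

/-- The point mass at a strategy profile. -/
noncomputable def pointMass (s : G.StrategyProfile) : G.StrategyProfile → ℝ :=
  Set.indicator {s} 1

/-- The price of stability for a set of equilibria. -/
noncomputable def PoS (K : Set (G.StrategyProfile → ℝ)) : ℝ :=
  sSup (G.distWelfare '' K) / G.optWelfare

/-- The strategy representability gap. -/
noncomputable def srGap : ℝ := (⨆ s, G.welfare s) / G.optWelfare

end BayesianGame

/-! A player's utility is the welfare minus a term independent of that player's own action. Expected
welfare is therefore a potential of the strategic form, and its maximizers are pure equilibria
(`pointMass_mem_BNE_of_isMax`). Conversely, the welfare of any distribution is an average over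
strategy profiles. Every price-of-stability bound thus becomes a comparison of the best strategy
profile with OPT.

Independent priors, lower bound: every player draws a fictitious type profile, overwrites its own
coordinate by the true type and plays its part of the optimum for the result. If each player does so
only with probability q and abstains otherwise, exchanging a coordinate of the true and the
fictitious profile shows that the expected value g satisfies g' ≥ OPT - g, so g(1) ≥ (1 - 1/e) OPT.
Fixing the best draws yields a strategy profile (`exists_one_sub_inv_exp_mul_le`,
`exists_welfare_ge_of_isIndependent`).

Arbitrary priors, lower bound (`optWelfare_le_of_isMax`): let s have maximal welfare W and give
every type a greedy list of m actions. The actions of s and of the m list profiles together are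
worth at most (m + 1) W. An optimal action adds to them at most 1/m of the value of its player's
list, and the lists are bounded because their entries are deviations from s. Taking m near √n
balances the terms.

Tightness uses coverage games. With random lists of d among d² items for d² players, a matching
covers almost everything, while independent choices behave like balls in bins. In the correlated
case about √n common items and one private item per player are randomly relabelled, so that no
player recognizes the private one. -/

namespace BayesianGame

/-! ### Monotone submodular set functions. -/

section Submodular

variable {E : Type*} {f : Set E → ℝ}

/-- Diminishing marginal returns of a monotone submodular function, for arbitrary elements. -/
theorem IsSubmodular.insert_sub_le (hf : IsSubmodular f) (hm : Monotone f) {X Y : Set E}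
    (h : X ⊆ Y) (u : E) : f (insert u Y) - f Y ≤ f (insert u X) - f X := by
  by_cases hu : u ∈ Y
  · rw [Set.insert_eq_of_mem hu, sub_self]
    exact sub_nonneg.2 (hm (Set.subset_insert u X))
  · simpa only [Set.union_singleton] using hf X Y h u hu

/-- The value of a union is at most the value of one part plus the marginals of the elements of
the other part. -/
theorem IsSubmodular.union_image_le (hf : IsSubmodular f) (hm : Monotone f) {ι : Type*}
    (P : Finset ι) (b : ι → E) (R : Set E) :
    f (R ∪ b '' P) ≤ f R + ∑ i ∈ P, (f (insert (b i) R) - f R) := by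
  classical
  induction P using Finset.induction_on with
  | empty => simp
  | insert i P hi ih =>
    have h := hf.insert_sub_le hm (Set.subset_union_left : R ⊆ R ∪ b '' P) (b i)
    rw [Finset.sum_insert hi, Finset.coe_insert, Set.image_insert_eq, Set.union_insert]
    linarith

/-- Subadditivity of non-negative monotone submodular functions. -/
theorem IsSubmodular.union_le [Finite E] (hf : IsSubmodular f) (hm : Monotone f)
    (h0 : ∀ X, 0 ≤ f X) (X Y : Set E) : f (X ∪ Y) ≤ f X + f Y := by
  induction Y, Y.toFinite using Set.Finite.induction_on with
  | empty => simpa using h0 ∅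
  | @insert a s _ _ ih =>
    have h := hf.insert_sub_le hm (Set.subset_union_right : s ⊆ X ∪ s) a
    rw [Set.union_insert]
    linarith

theorem IsSubmodular.iUnion_le [Finite E] (hf : IsSubmodular f) (hm : Monotone f)
    (h0 : ∀ X, 0 ≤ f X) {ι : Type*} (P : Finset ι) (X : ι → Set E) (Y : Set E)  :
    f (Y ∪ ⋃ i ∈ P, X i) ≤ f Y + ∑ i ∈ P, f (X i) := by
  classical
  induction P using Finset.induction_on with
  | empty => simp
  | insert i P hi ih =>
    rw [Finset.sum_insert hi, Finset.set_biUnion_insert, Set.union_left_comm]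
    have := hf.union_le hm h0 (X i) (Y ∪ ⋃ i ∈ P, X i)
    linarith

/-- Images preserve monotone submodularity. -/
theorem IsSubmodular.comp_image {E' : Type*} (hf : IsSubmodular f) (hm : Monotone f)
    (φ : E' → E) : IsSubmodular fun X => f (φ '' X) := by
  intro X Y h u _
  simpa only [Set.union_singleton, Set.image_insert_eq] using
    hf.insert_sub_le hm (Set.image_mono h) (φ u)

end Submodular

/-! ### Marginal contributions and expectations. -/

variable {n : ℕ} (G : BayesianGame.{u, v} n)

theorem chosen_univ (a : G.ActionProfile) (i : Fin n) :
    G.chosen a Set.univ = insert ⟨i, a i⟩ (G.chosen a {i}ᶜ) := by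
  simp only [chosen]
  rw [← Set.image_insert_eq (f := fun i => (⟨i, a i⟩ : G.Ground)), Set.insert_eq,
    Set.union_compl_self]

variable {G} in
theorem chosen_congr {a b : G.ActionProfile} {P : Set (Fin n)} (h : ∀ i ∈ P, a i = b i) :
    G.chosen a P = G.chosen b P :=
  Set.image_congr fun i hi => by rw [h i hi]

/-- The marginal contributions of the players add up to at most the value of all actions. -/
theorem sum_marginal_le {f : Set G.Ground → ℝ} (h0 : ∀ X, 0 ≤ f X) (hm : Monotone f)
    (hf : IsSubmodular f) (a : G.ActionProfile) :
    ∑ i, (f (G.chosen a Set.univ) - f (G.chosen a {i}ᶜ)) ≤ f (G.chosen a Set.univ) := by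
  -- Telescoping: a player's marginal at the full profile is at most the marginal over the players
  -- already counted in `P`.
  have key : ∀ P : Finset (Fin n),
      ∑ i ∈ P, (f (G.chosen a Set.univ) - f (G.chosen a {i}ᶜ)) ≤ f (G.chosen a P) := by
    intro P
    induction P using Finset.induction_on with
    | empty => simpa using h0 _
    | insert i P hi ih =>
      have hsub : G.chosen a P ⊆ G.chosen a {i}ᶜ :=
        Set.image_mono fun j hj hji => hi (by simpa [Set.mem_singleton_iff.1 hji] using hj)
      have h := hf.insert_sub_le hm hsub ⟨i, a i⟩
      rw [← G.chosen_univ] at h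
      rw [Finset.sum_insert hi, Finset.coe_insert]
      simp only [chosen] at h ih ⊢
      rw [Set.image_insert_eq]
      linarith
  simpa using key Finset.univ

section Expectation

theorem expect_mono {g h : G.TypeProfile → ℝ} (H : ∀ θ, g θ ≤ h θ) : G.expect g ≤ G.expect h :=
  Finset.sum_le_sum fun θ _ => mul_le_mul_of_nonneg_left (H θ) (G.ρ_mem.1 θ)

theorem expect_nonneg {g : G.TypeProfile → ℝ} (H : ∀ θ, 0 ≤ g θ) : 0 ≤ G.expect g :=
  Finset.sum_nonneg fun θ _ => mul_nonneg (G.ρ_mem.1 θ) (H θ)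

theorem expect_add (g h : G.TypeProfile → ℝ) :
    G.expect (fun θ => g θ + h θ) = G.expect g + G.expect h := by
  simp [expect, mul_add, Finset.sum_add_distrib]

theorem expect_sub (g h : G.TypeProfile → ℝ) :
    G.expect (fun θ => g θ - h θ) = G.expect g - G.expect h := by
  simp [expect, mul_sub, Finset.sum_sub_distrib]

theorem expect_sum {ι : Type*} (P : Finset ι) (g : ι → G.TypeProfile → ℝ) :
    G.expect (fun θ => ∑ i ∈ P, g i θ) = ∑ i ∈ P, G.expect (g i) := by
  simp only [expect, Finset.mul_sum]
  exact Finset.sum_comm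

theorem expect_const_mul (c : ℝ) (g : G.TypeProfile → ℝ) :
    G.expect (fun θ => c * g θ) = c * G.expect g := by
  simp only [expect, Finset.mul_sum]
  exact Finset.sum_congr rfl fun θ _ => by ring

theorem expect_const (c : ℝ) : G.expect (fun _ => c) = c := by
  simp [expect, ← Finset.sum_mul, G.ρ_mem.2]

end Expectation

/-! ### Strategic form, equilibria and the representability gap. -/

theorem strategicForm_isBasicUtilityGame (hG : G.IsBasicUtilityGame) :
    G.strategicForm.IsBasicUtilityGame := by
  obtain ⟨f, h0, hm, hf, hSW, hsum, hv⟩ := hG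
  -- Evaluation of strategies at `θ`. Averaging `f` over the images under these maps keeps it
  -- monotone and submodular.
  let φ : G.TypeProfile → G.strategicForm.Ground → G.Ground :=
    fun θ e => ⟨e.1, θ e.1, e.2.2 (θ e.1)⟩
  have hch : ∀ θ (s : G.strategicForm.ActionProfile) P,
      φ θ '' G.strategicForm.chosen s P = G.chosen (G.play (fun j => (s j).2) θ) P := by
    intro θ s P
    simp only [chosen, Set.image_image]
    rfl
  refine ⟨fun X => G.expect fun θ => f (φ θ '' X), fun X => G.expect_nonneg fun θ => h0 _,
    fun X Y h => G.expect_mono fun θ => hm (Set.image_mono h), ?_, ?_, ?_, ?_⟩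
  · intro X Y h u hu
    simp only [← expect_sub]
    exact G.expect_mono fun θ => hf.comp_image hm (φ θ) X Y h u hu
  · intro s
    simp only [hch, ← hSW]
    rfl
  · intro s
    simp only [strategicForm, ← expect_sum]
    exact G.expect_mono fun θ => hsum _
  · intro s i
    simp only [hch]
    simp only [strategicForm, ← expect_sub]
    simp only [hv]

variable {G}

theorem play_update_of_ne (s : G.StrategyProfile) {i j : Fin n} (h : j ≠ i) (r : G.Strategy i)
    (θ : G.TypeProfile) : G.play (Function.update s i r) θ j = G.play s θ j := by
  simp [play, Function.update_of_ne h]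

theorem chosen_play_update (s : G.StrategyProfile) (i : Fin n) (r : G.Strategy i)
    (θ : G.TypeProfile) :
    G.chosen (G.play (Function.update s i r) θ) {i}ᶜ = G.chosen (G.play s θ) {i}ᶜ :=
  chosen_congr fun _ hj => play_update_of_ne s hj r θ

theorem pointMass_apply_of_ne {s t : G.StrategyProfile} (h : t ≠ s) : G.pointMass s t = 0 :=
  Set.indicator_of_notMem (s := {s}) h 1

theorem pointMass_self (s : G.StrategyProfile) : G.pointMass s s = 1 :=
  Set.indicator_of_mem (Set.mem_singleton s) 1

theorem sum_pointMass_mul (s : G.StrategyProfile) (g : G.StrategyProfile → ℝ) :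
    ∑ t, G.pointMass s t * g t = g s := by
  rw [Finset.sum_eq_single s (fun t _ h => by rw [pointMass_apply_of_ne h, zero_mul]) (by simp),
    pointMass_self, one_mul]

theorem pointMass_mem_BNE_of_isMax (hG : G.IsBasicUtilityGame) {s : G.StrategyProfile}
    (hs : ∀ s', G.welfare s' ≤ G.welfare s) : G.pointMass s ∈ G.BNE := by
  classical
  obtain ⟨f, h0, hm, hf, hSW, hsum, hv⟩ := hG
  refine ⟨⟨⟨fun t => Set.indicator_nonneg (by simp) t, ?_⟩, fun i r => ?_⟩,
    fun i => Pi.single (s i) 1, fun i => single_mem_stdSimplex ℝ (s i), fun t => ?_⟩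
  · simpa using sum_pointMass_mul s 1
  -- The subtracted term survives the deviation unchanged, so only the two welfares have to be
  -- compared.
  · simp only [sum_pointMass_mul, hv, expect_sub, chosen_play_update]
    exact sub_le_sub_right (hs _) _
  · by_cases h : t = s
    · simp [h, pointMass_self]
    · obtain ⟨i, hi⟩ := Function.ne_iff.1 h
      rw [pointMass_apply_of_ne h, Finset.prod_eq_zero (Finset.mem_univ i)]
      simp [hi]

theorem distWelfare_eq (σ : G.StrategyProfile → ℝ) :
    G.distWelfare σ = ∑ s, σ s * G.welfare s := by
  simp only [distWelfare, expect_sum, expect_const_mul, welfare]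

theorem welfare_nonneg (s : G.StrategyProfile) : 0 ≤ G.welfare s :=
  G.expect_nonneg fun _ => G.SW_nonneg _

theorem distWelfare_pointMass (s : G.StrategyProfile) :
    G.distWelfare (G.pointMass s) = G.welfare s := by
  rw [distWelfare_eq, sum_pointMass_mul]

variable (G) in
theorem exists_isMax_welfare : ∃ s : G.StrategyProfile, ∀ s', G.welfare s' ≤ G.welfare s :=
  Finite.exists_max _

theorem welfare_le_iSup (s : G.StrategyProfile) : G.welfare s ≤ ⨆ s, G.welfare s :=
  le_ciSup (Set.finite_range _).bddAbove s

theorem distWelfare_le_iSup {σ : G.StrategyProfile → ℝ} (hσ : σ ∈ stdSimplex ℝ G.StrategyProfile) :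
    G.distWelfare σ ≤ ⨆ s, G.welfare s := by
  rw [distWelfare_eq]
  calc _ ≤ ∑ s, σ s * ⨆ s, G.welfare s :=
        Finset.sum_le_sum fun s _ => mul_le_mul_of_nonneg_left (welfare_le_iSup s) (hσ.1 s)
    _ = _ := by rw [← Finset.sum_mul, hσ.2, one_mul]

variable (G) in
theorem optWelfare_nonneg : 0 ≤ G.optWelfare :=
  G.expect_nonneg fun _ => Real.iSup_nonneg fun _ => G.SW_nonneg _

variable (G) in
theorem bddAbove_distWelfare_SFCCE : BddAbove (G.distWelfare '' G.SFCCE) :=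
  ⟨_, Set.forall_mem_image.2 fun _ hσ => distWelfare_le_iSup hσ.1⟩

variable (G) in
theorem bddAbove_distWelfare_BNE : BddAbove (G.distWelfare '' G.BNE) :=
  G.bddAbove_distWelfare_SFCCE.mono (Set.image_mono fun _ h => h.1)

theorem srGap_le_PoS_BNE (hG : G.IsBasicUtilityGame) : G.srGap ≤ G.PoS G.BNE := by
  obtain ⟨s, hs⟩ := G.exists_isMax_welfare
  refine div_le_div_of_nonneg_right ?_ G.optWelfare_nonneg
  refine (ciSup_le hs).trans (le_csSup G.bddAbove_distWelfare_BNE ?_)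
  exact ⟨_, pointMass_mem_BNE_of_isMax hG hs, distWelfare_pointMass s⟩

variable (G) in
theorem PoS_BNE_le_PoS_SFCCE : G.PoS G.BNE ≤ G.PoS G.SFCCE := by
  -- Existence of equilibria is not needed: an empty set has supremum `0`, which is why the upper
  -- bound must be shown to be non-negative.
  refine div_le_div_of_nonneg_right (Real.sSup_le ?_ ?_) G.optWelfare_nonneg
  · rintro _ ⟨σ, hσ, rfl⟩
    exact le_csSup G.bddAbove_distWelfare_SFCCE ⟨σ, hσ.1, rfl⟩
  · refine Real.sSup_nonneg ?_
    rintro _ ⟨σ, hσ, rfl⟩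
    exact G.expect_nonneg fun _ => Finset.sum_nonneg fun s _ =>
      mul_nonneg (hσ.1.1 s) (G.SW_nonneg _)

variable (G) in
theorem PoS_SFCCE_le_srGap : G.PoS G.SFCCE ≤ G.srGap := by
  refine div_le_div_of_nonneg_right (Real.sSup_le ?_ ?_) G.optWelfare_nonneg
  · rintro _ ⟨σ, hσ, rfl⟩
    exact distWelfare_le_iSup hσ.1
  · exact Real.iSup_nonneg welfare_nonneg

theorem le_PoS_BNE_of_welfare (hG : G.IsBasicUtilityGame) (hO : 0 < G.optWelfare) {c : ℝ}
    {s : G.StrategyProfile} (h : c * G.optWelfare ≤ G.welfare s) : c ≤ G.PoS G.BNE :=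
  ((le_div_iff₀ hO).2 (h.trans (welfare_le_iSup s))).trans (srGap_le_PoS_BNE hG)

theorem PoS_SFCCE_le_of_welfare {c w : ℝ} (hw : 0 < w) (hO : w ≤ G.optWelfare)
    (h : ∀ s : G.StrategyProfile, G.welfare s ≤ c * w) : G.PoS G.SFCCE ≤ c := by
  refine G.PoS_SFCCE_le_srGap.trans ?_
  obtain ⟨s⟩ : Nonempty G.StrategyProfile := inferInstance
  have hc : 0 ≤ c := nonneg_of_mul_nonneg_left ((welfare_nonneg s).trans (h s)) hw
  exact (div_le_iff₀ (hw.trans_le hO)).2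
    ((ciSup_le h).trans (mul_le_mul_of_nonneg_left hO hc))

variable (G) in
/-- Optimal action profiles exist for every type profile. -/
theorem exists_optWelfare_eq : ∃ b : ∀ θ : G.TypeProfile, ∀ i, G.Act i (θ i),
    G.optWelfare = G.expect fun θ => G.SW fun i => ⟨θ i, b θ i⟩ := by
  have h : ∀ θ : G.TypeProfile, ∃ b : ∀ i, G.Act i (θ i),
      (G.SW fun i => ⟨θ i, b i⟩) = ⨆ a : ∀ i, G.Act i (θ i), G.SW fun i => ⟨θ i, a i⟩ :=
    fun θ => exists_eq_ciSup_of_finite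
  choose b hb using h
  exact ⟨b, by simp only [optWelfare, hb]⟩

theorem expect_le_optWelfare (b : ∀ θ : G.TypeProfile, ∀ i, G.Act i (θ i)) :
    (G.expect fun θ => G.SW fun i => ⟨θ i, b θ i⟩) ≤ G.optWelfare :=
  G.expect_mono fun θ => le_ciSup (f := fun a : ∀ i, G.Act i (θ i) => G.SW fun i => ⟨θ i, a i⟩)
    (Set.finite_range _).bddAbove (b θ)

end BayesianGame

/-! ### Lower bound for arbitrary priors. -/

namespace BayesianGame

/-- Greedily chosen elements have values that are large compared to all remaining marginals. -/
theorem IsSubmodular.exists_greedy {E α : Type*} [Finite α] [Nonempty α] {f : Set E → ℝ}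
    (hf : IsSubmodular f) (hm : Monotone f) (h0 : ∀ X, 0 ≤ f X) (e : α → E) :
    ∃ b : ℕ → α, ∀ (m : ℕ) (a : α),
      m * (f (insert (e a) ((fun j => e (b j)) '' (Finset.range m : Set ℕ))) -
        f ((fun j => e (b j)) '' (Finset.range m : Set ℕ))) ≤
      f ((fun j => e (b j)) '' (Finset.range m : Set ℕ)) := by
  have hmax : ∀ X : Set E, ∃ a : α, ∀ a', f (insert (e a') X) ≤ f (insert (e a) X) :=
    fun X => Finite.exists_max _
  choose pick hpick using hmax
  let S : ℕ → Set E := fun m => Nat.rec ∅ (fun _ X => insert (e (pick X)) X) m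
  have hS : ∀ m, (fun j => e (pick (S j))) '' (Finset.range m : Set ℕ) = S m := by
    intro m
    induction m with
    | zero => simp [S]
    | succ m ih => rw [Finset.range_add_one, Finset.coe_insert, Set.image_insert_eq, ih]
  refine ⟨fun j => pick (S j), fun m => ?_⟩
  simp only [hS]
  induction m with
  | zero => intro a; simpa using h0 _
  | succ m ih =>
    intro a
    have hstep : S (m + 1) = insert (e (pick (S m))) (S m) := rfl
    -- The new pick gains at least the old marginal of `a`, which pays for the factor growing to `m
    -- + 1`; the marginal of `a` itself only shrinks.
    have h1 := hf.insert_sub_le hm (Set.subset_insert (e (pick (S m))) (S m)) (e a)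
    have h2 := hpick (S m) a
    have h3 := mul_le_mul_of_nonneg_left h1 (Nat.cast_nonneg (α := ℝ) m)
    rw [hstep]
    push_cast
    linarith [ih a]

variable {n : ℕ} {G : BayesianGame.{u, v} n}

/-- In the factor, `n` comes from the values f(C i) ≤ W, `m` from the utilities summing to at most
W, and `m * (m + 1)` from the m + 1 profiles that form `Y`. -/
theorem optWelfare_le_of_isMax (hG : G.IsBasicUtilityGame) {s : G.StrategyProfile}
    (hs : ∀ s', G.welfare s' ≤ G.welfare s) (m : ℕ) :
    m * G.optWelfare ≤ (n + m + m * (m + 1)) * G.welfare s := by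
  obtain ⟨f, h0, hm, hf, hSW, -, -⟩ := hG
  obtain ⟨o, ho⟩ := G.exists_optWelfare_eq
  choose b hb using fun (i : Fin n) (t : G.Θ i) =>
    hf.exists_greedy hm h0 (fun a : G.Act i t => (⟨i, t, a⟩ : G.Ground))
  let X : ∀ i, G.TypeProfile → Set G.Ground := fun i θ =>
    (fun j => (⟨i, θ i, b i (θ i) j⟩ : G.Ground)) '' (Finset.range m : Set ℕ)
  let C : Fin n → G.TypeProfile → Set G.Ground := fun i θ => G.chosen (G.play s θ) {i}ᶜ
  let r : ℕ → G.StrategyProfile := fun j i t => b i t j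
  let ψ : Fin n → G.TypeProfile → ℝ := fun i θ =>
    f (insert ⟨i, θ i, o θ i⟩ (X i θ)) - f (X i θ)
  -- Playing the `j`-th list entry is a deviation from `s`, so in expectation it adds to `C i` at
  -- most what player `i` contributes under `s`.
  have hX : ∀ i, (G.expect fun θ => f (X i θ)) ≤
      (G.expect fun θ => f (C i θ)) + m * (G.welfare s - G.expect fun θ => f (C i θ)) := by
    intro i
    have hdev : ∀ j θ, f (insert ⟨i, θ i, b i (θ i) j⟩ (C i θ)) =
        G.SW (G.play (Function.update s i (r j i)) θ) := by
      intro j θ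
      rw [hSW, G.chosen_univ _ i, chosen_play_update]
      simp [play, C, r]
    calc (G.expect fun θ => f (X i θ))
        ≤ G.expect fun θ => f (C i θ) + ∑ j ∈ Finset.range m,
            (G.SW (G.play (Function.update s i (r j i)) θ) - f (C i θ)) := by
          refine G.expect_mono fun θ => (hm Set.subset_union_right).trans
            ((hf.union_image_le hm (Finset.range m) _ (C i θ)).trans_eq ?_)
          simp only [hdev]
      _ = (G.expect fun θ => f (C i θ)) + ∑ j ∈ Finset.range m,
            (G.welfare (Function.update s i (r j i)) - G.expect fun θ => f (C i θ)) := by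
          rw [expect_add, expect_sum]
          simp only [expect_sub, welfare]
      _ ≤ (G.expect fun θ => f (C i θ)) + ∑ j ∈ Finset.range m,
            (G.welfare s - G.expect fun θ => f (C i θ)) := by
          gcongr
          exact hs _
      _ = _ := by simp [mul_sub]
  have hC : ∀ i, (G.expect fun θ => f (C i θ)) ≤ G.welfare s := fun i =>
    G.expect_mono fun θ => by rw [hSW]; exact hm (Set.image_mono (Set.subset_univ _))
  have hv : ∑ i, (G.welfare s - G.expect fun θ => f (C i θ)) ≤ G.welfare s := by
    simp only [welfare, ← expect_sub, ← expect_sum, hSW]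
    exact G.expect_mono fun θ => G.sum_marginal_le h0 hm hf _
  have hψ : ∀ i, m * G.expect (ψ i) ≤
      G.welfare s + m * (G.welfare s - G.expect fun θ => f (C i θ)) := by
    intro i
    rw [← expect_const_mul]
    have := G.expect_mono fun θ => hb i (θ i) m (o θ i)
    exact this.trans ((hX i).trans (by linarith [hC i]))
  have hψ_sum : m * ∑ i, G.expect (ψ i) ≤ (n + m) * G.welfare s := by
    rw [Finset.mul_sum]
    refine (Finset.sum_le_sum fun i _ => hψ i).trans ?_
    rw [Finset.sum_add_distrib, ← Finset.mul_sum]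
    have := mul_le_mul_of_nonneg_left hv (Nat.cast_nonneg (α := ℝ) m)
    simp only [Finset.sum_const, Finset.card_univ, Fintype.card_fin, nsmul_eq_mul]
    linarith
  -- Add the optimal actions to `Y`. As `Y` contains every list, marginals over it are at most those
  -- over `X i`.
  have hO : G.optWelfare ≤ (m + 1) * G.welfare s + ∑ i, G.expect (ψ i) := by
    let Y : G.TypeProfile → Set G.Ground := fun θ =>
      G.chosen (G.play s θ) Set.univ ∪
        ⋃ j ∈ Finset.range m, G.chosen (G.play (r j) θ) Set.univ
    have hXY : ∀ i θ, X i θ ⊆ Y θ := by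
      rintro i θ _ ⟨j, hj, rfl⟩
      exact Or.inr (Set.mem_biUnion hj ⟨i, trivial, rfl⟩)
    calc G.optWelfare ≤ G.expect fun θ => (G.SW (G.play s θ) +
          ∑ j ∈ Finset.range m, G.SW (G.play (r j) θ)) + ∑ i, ψ i θ := by
          rw [ho]
          refine G.expect_mono fun θ => ?_
          have h1 := hf.union_image_le hm Finset.univ
            (fun i => (⟨i, θ i, o θ i⟩ : G.Ground)) (Y θ)
          have h2 := hf.iUnion_le hm h0 (Finset.range m)
            (fun j => G.chosen (G.play (r j) θ) Set.univ) (G.chosen (G.play s θ) Set.univ)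
          have h3 : ∑ i, (f (insert ⟨i, θ i, o θ i⟩ (Y θ)) - f (Y θ)) ≤ ∑ i, ψ i θ :=
            Finset.sum_le_sum fun i _ => hf.insert_sub_le hm (hXY i θ) _
          simp only [hSW]
          have h4 : G.chosen (fun i => ⟨θ i, o θ i⟩) Set.univ ⊆ Y θ ∪
              (fun i => (⟨i, θ i, o θ i⟩ : G.Ground)) '' (Finset.univ : Finset (Fin n)) := by
            rw [Finset.coe_univ]
            exact Set.subset_union_right
          linarith [hm h4]
      _ = G.welfare s + ∑ j ∈ Finset.range m, G.welfare (r j) + ∑ i, G.expect (ψ i) := by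
          simp only [expect_add, expect_sum, welfare]
      _ ≤ G.welfare s + ∑ j ∈ Finset.range m, G.welfare s + ∑ i, G.expect (ψ i) := by
          gcongr
          exact hs _
      _ = _ := by simp; ring
  have := mul_le_mul_of_nonneg_left hO (Nat.cast_nonneg (α := ℝ) m)
  linarith

theorem one_div_sqrt_le_PoS_BNE (hn : 1 ≤ n) (hG : G.IsBasicUtilityGame)
    (hO : 0 < G.optWelfare) : 1 / 6 / √(n : ℝ) ≤ G.PoS G.BNE := by
  obtain ⟨s, hs⟩ := G.exists_isMax_welfare
  refine le_PoS_BNE_of_welfare (s := s) hG hO ?_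
  have h := optWelfare_le_of_isMax hG hs n.sqrt
  have hm : (1 : ℝ) ≤ n.sqrt := by exact_mod_cast Nat.sqrt_pos.2 hn
  have hn' : (n : ℝ) ≤ n.sqrt * n.sqrt + n.sqrt + n.sqrt := by exact_mod_cast Nat.sqrt_le_add n
  have hsq : (n.sqrt : ℝ) ≤ √n := Real.nat_sqrt_le_real_sqrt
  have hw := welfare_nonneg s
  -- With m = `n.sqrt` and n ≤ m² + 2m, the left side is at most 2m² + 4m ≤ 6m².
  have h1 : (n + n.sqrt + n.sqrt * (n.sqrt + 1) : ℝ) ≤ n.sqrt * (6 * √n) := by nlinarith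
  have h2 := h.trans (mul_le_mul_of_nonneg_right h1 hw)
  rw [mul_assoc] at h2
  have h3 := le_of_mul_le_mul_left h2 (by linarith)
  rw [div_div, div_mul_eq_mul_div, one_mul]
  exact div_le_of_le_mul₀ (by positivity) hw (by linarith)

end BayesianGame

/-! ### Lower bound for independent priors. -/

/-- Resampling one coordinate of a product distribution. -/
theorem sum_prod_erase_mul {I K : Type*} [Fintype I] [DecidableEq I] [Fintype K]
    {W : K → ℝ} (hW : ∑ k, W k = 1) (c : K → ℝ) (F : (I → K) → ℝ) (i : I) :
    ∑ x : I → K, (∏ j ∈ Finset.univ.erase i, W (x j)) * c (x i) * F x =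
      ∑ x : I → K, (∏ j, W (x j)) * ∑ k, c k * F (Function.update x i k) := by
  -- A fresh copy `k` of total weight one supplies the missing factor `W` and is then exchanged with
  -- coordinate `i`.
  have hinv : Function.Involutive
      fun p : (I → K) × K => (Function.update p.1 i p.2, p.1 i) := by
    rintro ⟨x, k⟩
    simp
  calc _ = ∑ p : (I → K) × K, (∏ j ∈ Finset.univ.erase i, W (p.1 j)) * c (p.1 i) * F p.1 * W p.2 := by
        rw [Fintype.sum_prod_type]
        simp only [← Finset.mul_sum, hW, mul_one]
    _ = ∑ p : (I → K) × K, (∏ j ∈ Finset.univ.erase i, W (p.1 j)) * c p.2 *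
          F (Function.update p.1 i p.2) * W (p.1 i) := by
        refine Fintype.sum_equiv hinv.toPerm _ _ ?_
        rintro ⟨x, k⟩
        have : ∏ j ∈ Finset.univ.erase i, W (Function.update x i k j) =
            ∏ j ∈ Finset.univ.erase i, W (x j) :=
          Finset.prod_congr rfl fun j hj => by
            rw [Function.update_of_ne (Finset.ne_of_mem_erase hj)]
        simp [this]
    _ = _ := by
        rw [Fintype.sum_prod_type]
        refine Finset.sum_congr rfl fun x _ => ?_
        rw [← Finset.mul_prod_erase Finset.univ _ (Finset.mem_univ i), Finset.mul_sum]
        exact Finset.sum_congr rfl fun k _ => by ring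

/-- A solution of the differential inequality `g' ≥ c - g` with a non-negative initial value
reaches `(1 - 1 / e) * c` at time one. -/
theorem one_sub_inv_exp_mul_le_of_deriv {g g' : ℝ → ℝ} {c : ℝ} (hg : ∀ q, HasDerivAt g (g' q) q)
    (h0 : 0 ≤ g 0) (h : ∀ q ∈ Set.Icc (0 : ℝ) 1, c - g q ≤ g' q) :
    (1 - 1 / Real.exp 1) * c ≤ g 1 := by
  -- Integrating factor: the differential inequality makes exp q * (g q - c) non-decreasing on [0,
  -- 1].
  have hd : ∀ q, HasDerivAt (fun q => Real.exp q * (g q - c))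
      (Real.exp q * (g q - c) + Real.exp q * g' q) q := fun q =>
    (Real.hasDerivAt_exp q).mul ((hg q).sub_const c)
  have hmono : MonotoneOn (fun q => Real.exp q * (g q - c)) (Set.Icc 0 1) := by
    refine monotoneOn_of_deriv_nonneg (convex_Icc 0 1)
      (fun q _ => (hd q).continuousAt.continuousWithinAt)
      (fun q _ => (hd q).differentiableAt.differentiableWithinAt) fun q hq => ?_
    rw [(hd q).deriv, ← mul_add]
    exact mul_nonneg (Real.exp_nonneg q) (by linarith [h q (interior_subset hq)])
  have h1 := hmono (by simp) (by simp) zero_le_one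
  simp only [Real.exp_zero, one_mul] at h1
  have he := Real.exp_pos 1
  have h2 : -c / Real.exp 1 ≤ g 1 - c := by
    rw [div_le_iff₀ he]
    linarith
  have h3 : (1 - 1 / Real.exp 1) * c = c + -c / Real.exp 1 := by ring
  linarith

/-- If the marginal gains of resampling the coordinates of a partial assignment always make up
for the missing amount, then some full assignment has at least `1 - 1 / e` of the target value. -/
theorem exists_one_sub_inv_exp_mul_le {I K : Type*} [Fintype I] [DecidableEq I] [Fintype K]
    {w : K → ℝ} (hw : w ∈ stdSimplex ℝ K) {F : (I → Option K) → ℝ} (hF : ∀ x, 0 ≤ F x) {c : ℝ}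
    (h : ∀ x, c - F x ≤ ∑ i, ∑ k, w k *
      (F (Function.update x i (some k)) - F (Function.update x i none))) :
    ∃ y : I → K, (1 - 1 / Real.exp 1) * c ≤ F fun i => some (y i) := by
  -- `W q` gives `none` with probability 1 - q and otherwise a draw from `w`; `W'` is its derivative
  -- in `q`.
  let W : ℝ → Option K → ℝ := fun q o => o.elim (1 - q) fun k => q * w k
  let W' : Option K → ℝ := fun o => o.elim (-1) w
  have hW : ∀ q, ∑ o, W q o = 1 := by
    intro q
    simp [W, Fintype.sum_option, ← Finset.mul_sum, hw.2]
  have hWd : ∀ q o, HasDerivAt (fun q => W q o) (W' o) q := by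
    rintro q (_ | k)
    · simpa [W, W'] using (hasDerivAt_id q).const_sub 1
    · simpa [W, W'] using (hasDerivAt_id q).mul_const (w k)
  have hWn : ∀ q ∈ Set.Icc (0 : ℝ) 1, ∀ o, 0 ≤ W q o := by
    rintro q ⟨h0, h1⟩ (_ | k)
    · simpa [W] using h1
    · exact mul_nonneg h0 (hw.1 k)
  have hprod : ∀ q, ∑ x : I → Option K, ∏ i, W q (x i) = 1 := by
    intro q
    rw [← Fintype.prod_sum fun (_ : I) o => W q o]
    simp [hW]
  let g : ℝ → ℝ := fun q => ∑ x : I → Option K, (∏ i, W q (x i)) * F x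
  have hg : ∀ q, HasDerivAt g (∑ x : I → Option K,
      (∑ i, (∏ j ∈ Finset.univ.erase i, W q (x j)) • W' (x i)) * F x) q := fun q =>
    HasDerivAt.fun_sum fun x _ =>
      (HasDerivAt.fun_finsetProd fun i _ => hWd q (x i)).mul_const (F x)
  have key := one_sub_inv_exp_mul_le_of_deriv (c := c) hg
    (Finset.sum_nonneg fun x _ => mul_nonneg
      (Finset.prod_nonneg fun i _ => hWn 0 (by simp) _) (hF x)) fun q hq => by
    have hswap : ∑ x : I → Option K,
        (∑ i, (∏ j ∈ Finset.univ.erase i, W q (x j)) • W' (x i)) * F x =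
        ∑ x : I → Option K, (∏ j, W q (x j)) *
          ∑ i, ∑ o, W' o * F (Function.update x i o) := by
      simp only [Finset.sum_mul, Finset.mul_sum (s := (Finset.univ : Finset I)), smul_eq_mul]
      rw [Finset.sum_comm, Finset.sum_comm (t := (Finset.univ : Finset I))]
      exact Finset.sum_congr rfl fun i _ => sum_prod_erase_mul (hW q) W' F i
    calc c - g q = ∑ x : I → Option K, (∏ j, W q (x j)) * (c - F x) := by
          simp only [g, mul_sub, Finset.sum_sub_distrib, ← Finset.sum_mul, hprod, one_mul]
      _ ≤ ∑ x : I → Option K, (∏ j, W q (x j)) *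
          ∑ i, ∑ o, W' o * F (Function.update x i o) := by
          refine Finset.sum_le_sum fun x _ => mul_le_mul_of_nonneg_left ((h x).trans_eq ?_)
            (Finset.prod_nonneg fun i _ => hWn q hq _)
          refine Finset.sum_congr rfl fun i _ => ?_
          simp only [Fintype.sum_option, W', mul_sub, Finset.sum_sub_distrib, ← Finset.sum_mul,
            hw.2, Option.elim]
          ring
      _ = _ := hswap.symm
  have hK : Nonempty K := by
    by_contra hK
    have := not_nonempty_iff.1 hK
    simpa using hw.2
  obtain ⟨y, hy⟩ := Finite.exists_max fun y : I → K => F fun i => some (y i)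
  refine ⟨y, key.trans ?_⟩
  calc g 1 ≤ ∑ x : I → Option K, (∏ i, W 1 (x i)) * F fun i => some (y i) := by
        refine Finset.sum_le_sum fun x _ => ?_
        -- At q = 1 the value `none` has weight zero, so only full assignments contribute.
        by_cases hx : ∃ i, x i = none
        · obtain ⟨i, hi⟩ := hx
          rw [Finset.prod_eq_zero (Finset.mem_univ i) (by simp [hi, W])]
          simp
        · push Not at hx
          choose z hz using fun i => Option.ne_none_iff_exists'.1 (hx i)
          rw [show x = fun i => some (z i) from funext hz]
          exact mul_le_mul_of_nonneg_left (hy z)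
            (Finset.prod_nonneg fun i _ => hWn 1 (by simp) _)
    _ = _ := by rw [← Finset.sum_mul, hprod, one_mul]

namespace BayesianGame

variable {n : ℕ} {G : BayesianGame.{u, v} n}

/-- Exchanging a coordinate of two independent type profiles does not change expectations. -/
theorem IsIndependent.expect_expect_update (hI : G.IsIndependent)
    (K : G.TypeProfile → G.TypeProfile → ℝ) (i : Fin n) :
    (G.expect fun φ => G.expect fun θ =>
      K (Function.update φ i (θ i)) (Function.update θ i (φ i))) =
    G.expect fun φ => G.expect fun θ => K φ θ := by
  obtain ⟨μ, -, hμ⟩ := hI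
  have hinv : Function.Involutive fun p : G.TypeProfile × G.TypeProfile =>
      (Function.update p.1 i (p.2 i), Function.update p.2 i (p.1 i)) := by
    rintro ⟨φ, θ⟩
    simp
  have hρ : ∀ φ θ : G.TypeProfile, G.ρ (Function.update φ i (θ i)) *
      G.ρ (Function.update θ i (φ i)) = G.ρ φ * G.ρ θ := by
    intro φ θ
    simp only [hμ, ← Finset.prod_mul_distrib]
    refine Finset.prod_congr rfl fun j _ => ?_
    by_cases hj : j = i
    · subst hj
      simp [mul_comm]
    · simp [hj]
  simp only [expect, Finset.mul_sum, ← mul_assoc]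
  rw [← Fintype.sum_prod_type', ← Fintype.sum_prod_type']
  exact Fintype.sum_equiv hinv.toPerm _ _ fun ⟨φ, θ⟩ => by simp [hρ]

theorem exists_welfare_ge_of_isIndependent (hG : G.IsBasicUtilityGame) (hI : G.IsIndependent) :
    ∃ s : G.StrategyProfile, (1 - 1 / Real.exp 1) * G.optWelfare ≤ G.welfare s := by
  obtain ⟨f, h0, hm, hf, hSW, -, -⟩ := hG
  obtain ⟨o, ho⟩ := G.exists_optWelfare_eq
  let b : G.TypeProfile → G.ActionProfile := fun θ i => ⟨θ i, o θ i⟩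
  -- `none` marks an abstaining player and `some φ` one with fictitious profile `φ`. Each action
  -- depends on the true profile only through the player's own type.
  let S : (Fin n → Option G.TypeProfile) → G.TypeProfile → Set G.Ground := fun x θ =>
    {e | ∃ i φ, x i = some φ ∧ e = ⟨i, b (Function.update φ i (θ i)) i⟩}
  have hSsome : ∀ x i φ θ, S (Function.update x i (some φ)) θ =
      insert ⟨i, b (Function.update φ i (θ i)) i⟩ (S (Function.update x i none) θ) := by
    intro x i φ θ
    ext e
    simp only [S, Set.mem_ofPred_eq, Set.mem_insert_iff]
    constructor
    · rintro ⟨j, φ', hj, rfl⟩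
      by_cases hji : j = i
      · subst hji
        rw [Function.update_self, Option.some.injEq] at hj
        exact Or.inl (by rw [hj])
      · rw [Function.update_of_ne hji] at hj
        exact Or.inr ⟨j, φ', by rwa [Function.update_of_ne hji], rfl⟩
    · rintro (rfl | ⟨j, φ', hj, rfl⟩)
      · exact ⟨i, φ, by simp, rfl⟩
      · by_cases hji : j = i
        · subst hji
          simp at hj
        · rw [Function.update_of_ne hji] at hj
          exact ⟨j, φ', by rwa [Function.update_of_ne hji], rfl⟩
  have hSnone : ∀ x i θ, S (Function.update x i none) θ ⊆ S x θ := by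
    rintro x i θ _ ⟨j, φ, hj, rfl⟩
    by_cases hji : j = i
    · subst hji
      simp at hj
    · rw [Function.update_of_ne hji] at hj
      exact ⟨j, φ, hj, rfl⟩
  -- While player `i` abstains, the set ignores the type of `i`, so the exchange below affects only
  -- the added action.
  have hSupd : ∀ x i θ t, S (Function.update x i none) (Function.update θ i t) =
      S (Function.update x i none) θ := by
    intro x i θ t
    ext e
    refine exists_congr fun j => exists_congr fun φ => and_congr_right fun hj => ?_
    have hji : j ≠ i := by
      rintro rfl
      simp at hj
    rw [Function.update_of_ne hji]
  obtain ⟨y, hy⟩ := exists_one_sub_inv_exp_mul_le (I := Fin n) G.ρ_mem (c := G.optWelfare)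
    (F := fun x => G.expect fun θ => f (S x θ)) (fun x => G.expect_nonneg fun θ => h0 _) (by
      intro x
      have hi : ∀ i, ∑ φ, G.ρ φ * ((G.expect fun θ => f (S (Function.update x i (some φ)) θ)) -
          G.expect fun θ => f (S (Function.update x i none) θ)) =
          G.expect fun φ => G.expect fun θ =>
            f (insert ⟨i, b φ i⟩ (S (Function.update x i none) θ)) -
              f (S (Function.update x i none) θ) := by
        intro i
        -- After the exchange, the added actions of all players belong to the optimum of one profile
        -- `φ`, independent of `θ`.
        rw [← hI.expect_expect_update _ i]
        simp only [hSupd, ← hSsome, ← expect_sub]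
        rfl
      simp only [hi, ← expect_sum]
      calc _ = G.expect fun φ => G.expect fun θ => G.SW (b φ) - f (S x θ) := by
            simp only [expect_sub, expect_const, ho]
            rfl
        _ ≤ _ := by
            refine G.expect_mono fun φ => G.expect_mono fun θ => ?_
            have h1 := hf.union_image_le hm Finset.univ
              (fun i => (⟨i, b φ i⟩ : G.Ground)) (S x θ)
            have h2 : ∑ i, (f (insert ⟨i, b φ i⟩ (S x θ)) - f (S x θ)) ≤ _ :=
              Finset.sum_le_sum fun i _ => hf.insert_sub_le hm (hSnone x i θ) ⟨i, b φ i⟩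
            have h3 : G.chosen (b φ) Set.univ ⊆ S x θ ∪
                (fun i => (⟨i, b φ i⟩ : G.Ground)) '' (Finset.univ : Finset (Fin n)) := by
              rw [Finset.coe_univ]
              exact Set.subset_union_right
            rw [hSW]
            linarith [hm h3])
  have hs : ∀ i (t : G.Θ i), ∃ a : G.Act i t,
      (⟨t, a⟩ : G.Action i) = b (Function.update (y i) i t) i := by
    intro i t
    have h1 : (b (Function.update (y i) i t) i).1 = t := Function.update_self i t (y i)
    rcases hb : b (Function.update (y i) i t) i with ⟨t', a⟩
    rw [hb] at h1
    subst h1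
    exact ⟨a, rfl⟩
  choose s hs using hs
  refine ⟨s, hy.trans_eq (congrArg G.expect (funext fun θ => ?_))⟩
  rw [hSW]
  congr 1
  ext e
  simp only [S, chosen, play, hs, Option.some.injEq, Set.image_univ, Set.mem_range,
    Set.mem_ofPred_eq]
  constructor
  · rintro ⟨i, φ, rfl, rfl⟩
    exact ⟨i, rfl⟩
  · rintro ⟨i, rfl⟩
    exact ⟨i, _, rfl, rfl⟩

theorem one_sub_inv_exp_le_PoS_BNE (hG : G.IsBasicUtilityGame) (hI : G.IsIndependent)
    (hO : 0 < G.optWelfare) : 1 - 1 / Real.exp 1 ≤ G.PoS G.BNE :=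
  let ⟨_, hs⟩ := exists_welfare_ge_of_isIndependent hG hI
  le_PoS_BNE_of_welfare hG hO hs

end BayesianGame

/-! ### Coverage games. -/

namespace BayesianGame

theorem isSubmodular_ncard_image {E M : Type*} [Finite M] (g : E → M) :
    IsSubmodular fun X : Set E => ((g '' X).ncard : ℝ) := by
  have hm : Monotone fun X : Set M => (X.ncard : ℝ) := fun X Y h =>
    Nat.cast_le.2 (Set.ncard_le_ncard h)
  refine IsSubmodular.comp_image (f := fun X : Set M => (X.ncard : ℝ)) ?_ hm g
  intro X Y h u hu
  simp only [Set.union_singleton]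
  rw [Set.ncard_insert_of_notMem hu, Set.ncard_insert_of_notMem fun hX => hu (h hX)]
  simp

/-- The game in which every action covers one item, the social welfare is the number of covered
items, and the utility of a player is the number of items that nobody else covers. -/
noncomputable def coverageGame {n : ℕ} (Θ : Fin n → Type) [∀ i, Fintype (Θ i)]
    [∀ i, DecidableEq (Θ i)] (Act : ∀ i, Θ i → Type) [∀ i t, Fintype (Act i t)]
    [∀ i t, Nonempty (Act i t)] (ρ : (∀ i, Θ i) → ℝ) (hρ : ρ ∈ stdSimplex ℝ (∀ i, Θ i))
    {M : Type} [Finite M] (item : ∀ i t, Act i t → M) : BayesianGame.{0, 0} n where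
  Θ := Θ
  Act := Act
  ρ := ρ
  ρ_mem := hρ
  v := fun i a => (Set.range fun j => item j (a j).1 (a j).2).ncard -
    ((fun j => item j (a j).1 (a j).2) '' {i}ᶜ).ncard
  v_nonneg := fun i a => sub_nonneg.2 (by
    exact_mod_cast Set.ncard_le_ncard (Set.image_subset_range _ _))
  SW := fun a => (Set.range fun j => item j (a j).1 (a j).2).ncard
  SW_nonneg := fun _ => Nat.cast_nonneg _

theorem coverageGame_isBasicUtilityGame {n : ℕ} (Θ : Fin n → Type) [∀ i, Fintype (Θ i)]
    [∀ i, DecidableEq (Θ i)] (Act : ∀ i, Θ i → Type) [∀ i t, Fintype (Act i t)]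
    [∀ i t, Nonempty (Act i t)] (ρ : (∀ i, Θ i) → ℝ) (hρ : ρ ∈ stdSimplex ℝ (∀ i, Θ i))
    {M : Type} [Finite M] (item : ∀ i t, Act i t → M) :
    (coverageGame Θ Act ρ hρ item).IsBasicUtilityGame := by
  set G := coverageGame Θ Act ρ hρ item
  let g : G.Ground → M := fun e => item e.1 e.2.1 e.2.2
  have h0 : ∀ X : Set G.Ground, (0 : ℝ) ≤ (g '' X).ncard := fun _ => Nat.cast_nonneg _
  have hm : Monotone fun X : Set G.Ground => ((g '' X).ncard : ℝ) := fun X Y h =>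
    Nat.cast_le.2 (Set.ncard_le_ncard (Set.image_mono h))
  have hf := isSubmodular_ncard_image g
  have hch : ∀ (a : G.ActionProfile) P,
      g '' G.chosen a P = (fun j => item j (a j).1 (a j).2) '' P := by
    intro a P
    simp only [chosen, Set.image_image]
    rfl
  have hSW : ∀ a, G.SW a = (g '' G.chosen a Set.univ).ncard := by
    intro a
    rw [hch, Set.image_univ]
    rfl
  have hv : ∀ a i, G.v i a = G.SW a - (g '' G.chosen a {i}ᶜ).ncard := by
    intro a i
    rw [hch]
    rfl
  refine ⟨_, h0, hm, hf, hSW, fun a => ?_, hv⟩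
  simp only [hv, hSW]
  exact G.sum_marginal_le h0 hm hf a

end BayesianGame

/-! ### Tightness for independent priors. -/

section Independent

/-- Independent random choices of the same number of items as there are players, none of which is
likely to be made by any player, cover at most about a fraction of `1 - 1 / e` of the items. -/
theorem sum_prod_mul_ncard_range_le {I M : Type*} [Fintype I] [DecidableEq I] [Fintype M]
    (hIM : Fintype.card M = Fintype.card I) {Θ : I → Type*} [∀ i, Fintype (Θ i)]
    {μ : ∀ i, Θ i → ℝ} (hμ : ∀ i, μ i ∈ stdSimplex ℝ (Θ i)) (h : ∀ i, Θ i → M) {δ : ℝ}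
    (hδ : δ < 1) (hp : ∀ i j, ∑ t, μ i t * Set.indicator {j} 1 (h i t) ≤ δ) :
    ∑ θ : ∀ i, Θ i, (∏ i, μ i (θ i)) * (Set.range fun i => h i (θ i)).ncard ≤
      Fintype.card I * (1 - Real.exp (-(1 / (1 - δ)))) := by
  classical
  have hδ' : 0 < 1 - δ := sub_pos.2 hδ
  set κ := 1 / (1 - δ)
  let p : I → M → ℝ := fun i j => ∑ t, μ i t * Set.indicator {j} 1 (h i t)
  have hp0 : ∀ i j, 0 ≤ p i j := fun i j => Finset.sum_nonneg fun t _ =>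
    mul_nonneg ((hμ i).1 t) (Set.indicator_nonneg (by simp) _)
  have hpsum : ∀ i, ∑ j, p i j = 1 := by
    intro i
    simp only [p]
    rw [Finset.sum_comm, ← (hμ i).2]
    refine Finset.sum_congr rfl fun t _ => ?_
    rw [← Finset.mul_sum]
    simp [Set.indicator_apply]
  -- The event that item `j` is missed is written as a product over players, so that its expectation
  -- factorizes.
  have hcard : ∀ θ : ∀ i, Θ i, ((Set.range fun i => h i (θ i)).ncard : ℝ) =
      ∑ j, (1 - ∏ i, (1 - Set.indicator {j} 1 (h i (θ i)))) := by
    intro θ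
    have : ∀ j, (1 - ∏ i, (1 - Set.indicator {j} (1 : M → ℝ) (h i (θ i)))) =
        if j ∈ Set.range (fun i => h i (θ i)) then 1 else 0 := by
      intro j
      split_ifs with hj
      · obtain ⟨i, hi⟩ := hj
        rw [Finset.prod_eq_zero (Finset.mem_univ i) (by simp [← hi]), sub_zero]
      · rw [Finset.prod_eq_one fun i _ => ?_, sub_self]
        rw [Set.indicator_of_notMem (s := {j}) (fun hi => hj ⟨i, hi⟩), sub_zero]
    simp only [this]
    rw [Finset.sum_boole, Set.ncard_eq_toFinset_card']
    congr 2
    ext j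
    simp
  have hprod : ∀ j, ∑ θ : ∀ i, Θ i,
      (∏ i, μ i (θ i)) * ∏ i, (1 - Set.indicator {j} (1 : M → ℝ) (h i (θ i))) =
      ∏ i, (1 - p i j) := by
    intro j
    simp only [← Finset.prod_mul_distrib]
    rw [← Fintype.prod_sum fun i t => μ i t * (1 - Set.indicator {j} (1 : M → ℝ) (h i t))]
    simp only [mul_sub, mul_one, Finset.sum_sub_distrib, (hμ _).2, p]
  have hone : ∑ θ : ∀ i, Θ i, ∏ i, μ i (θ i) = 1 := by
    rw [← Fintype.prod_sum]
    simp [(hμ _).2]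
  -- From 1/(1 - p) = 1 + p/(1 - p) ≤ exp(p/(1 - p)) and p ≤ δ.
  have hexp : ∀ i j, Real.exp (-(κ * p i j)) ≤ 1 - p i j := by
    intro i j
    have h1 : 0 < 1 - p i j := hδ'.trans_le (by linarith [hp i j])
    have h2 : 1 + p i j / (1 - p i j) = (1 - p i j)⁻¹ := by field_simp; ring
    have h3 : (1 - p i j)⁻¹ ≤ Real.exp (κ * p i j) := by
      rw [← h2, add_comm]
      refine (Real.add_one_le_exp _).trans (Real.exp_le_exp.2 ?_)
      rw [div_eq_mul_one_div, mul_comm]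
      exact mul_le_mul_of_nonneg_right
        (one_div_le_one_div_of_le hδ' (by linarith [hp i j])) (hp0 i j)
    rw [Real.exp_neg]
    exact inv_le_of_inv_le₀ h1 h3
  -- Convexity: the tangent of exp(-κx) at x = 1, the average of the sums ∑ i, p i j since there are
  -- as many items as players.
  have hlow : Fintype.card I * Real.exp (-κ) ≤ ∑ j, ∏ i, (1 - p i j) := by
    calc (Fintype.card I * Real.exp (-κ) : ℝ)
        = ∑ j, Real.exp (-κ) * (1 + (κ - κ * ∑ i, p i j)) := by
          have : ∑ j, ∑ i, p i j = Fintype.card I := by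
            rw [Finset.sum_comm]
            simp [hpsum]
          rw [← Finset.mul_sum, Finset.sum_add_distrib, Finset.sum_sub_distrib, ← Finset.mul_sum,
            this]
          simp [hIM]
          ring
      _ ≤ ∑ j, ∏ i, (1 - p i j) := by
          refine Finset.sum_le_sum fun j _ => ?_
          calc Real.exp (-κ) * (1 + (κ - κ * ∑ i, p i j))
              ≤ Real.exp (-κ) * Real.exp (κ - κ * ∑ i, p i j) := by
                refine mul_le_mul_of_nonneg_left ?_ (Real.exp_nonneg _)
                rw [add_comm]
                exact Real.add_one_le_exp _
            _ = ∏ i, Real.exp (-(κ * p i j)) := by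
                rw [← Real.exp_add, ← Real.exp_sum, Finset.sum_neg_distrib, ← Finset.mul_sum]
                congr 1
                ring
            _ ≤ _ := Finset.prod_le_prod (fun i _ => Real.exp_nonneg _) fun i _ => hexp i j
  calc ∑ θ : ∀ i, Θ i, (∏ i, μ i (θ i)) * ((Set.range fun i => h i (θ i)).ncard : ℝ)
      = ∑ j, (1 - ∏ i, (1 - p i j)) := by
        simp only [hcard, Finset.mul_sum]
        rw [Finset.sum_comm]
        simp only [mul_sub, mul_one, Finset.sum_sub_distrib, hone, hprod]
    _ = Fintype.card I - ∑ j, ∏ i, (1 - p i j) := by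
        rw [Finset.sum_sub_distrib]
        simp [hIM]
    _ ≤ _ := by linarith

theorem pow_succ_add_mul_pow_le (n d : ℕ) : n ^ (d + 1) + (d + 1) * n ^ d ≤ (n + 1) ^ (d + 1) := by
  induction d with
  | zero => simp
  | succ d ih =>
    calc n ^ (d + 2) + (d + 1 + 1) * n ^ (d + 1)
        ≤ (n ^ (d + 1) + (d + 1) * n ^ d) * (n + 1) := by
          have : (n ^ (d + 1) + (d + 1) * n ^ d) * (n + 1) =
            n ^ (d + 2) + (d + 1 + 1) * n ^ (d + 1) + (d + 1) * n ^ d := by ring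
          omega
      _ ≤ _ := Nat.mul_le_mul_right _ ih

/-- Discrete form of ∫ x^d = n^(d+1)/(d+1). It bounds the expected number of players left unmatched.
-/
theorem mul_sum_range_pow_le (n d : ℕ) : (d + 1) * ∑ i ∈ Finset.range n, i ^ d ≤ n ^ (d + 1) := by
  induction n with
  | zero => simp
  | succ n ih =>
    rw [Finset.sum_range_succ, mul_add]
    linarith [pow_succ_add_mul_pow_le n d]

/-- Greedy matching: if each of `r` players has a list of `d` random items out of `m`, then the
players can choose items from their lists such that many different items are chosen on average. -/
theorem exists_matching {m d : ℕ} (hm : 0 < m) (hd : 0 < d) (r : ℕ) :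
    ∃ g : (Fin r → Fin d → Fin m) → Fin r → Fin d,
      ((m : ℝ) ^ d) ^ r * (r - ∑ i ∈ Finset.range r, (i : ℝ) ^ d / (m : ℝ) ^ d) ≤
        ∑ θ : Fin r → Fin d → Fin m, ((Finset.univ.image fun i => θ i (g θ i)).card : ℝ) := by
  classical
  have hm' : (0 : ℝ) < (m : ℝ) ^ d := by positivity
  induction r with
  | zero => exact ⟨fun _ i => i.elim0, by simp⟩
  | succ r ih =>
    obtain ⟨g, hg⟩ := ih
    let U : (Fin r → Fin d → Fin m) → Finset (Fin m) :=
      fun θ => Finset.univ.image fun i => θ i (g θ i)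
    have hU : ∀ θ, (U θ).card ≤ r := fun θ => Finset.card_image_le.trans (by simp)
    have hch : ∀ (V : Finset (Fin m)) (t : Fin d → Fin m), ∃ a : Fin d, (∃ a', t a' ∉ V) → t a ∉ V := by
      intro V t
      by_cases h : ∃ a', t a' ∉ V
      · exact ⟨h.choose, fun _ => h.choose_spec⟩
      · exact ⟨⟨0, hd⟩, fun h' => absurd h' h⟩
    choose pick hpick using hch
    refine ⟨fun θ => Fin.snoc (g (Fin.init θ)) (pick (U (Fin.init θ)) (θ (Fin.last r))), ?_⟩
    have himage : ∀ (t : Fin d → Fin m) (θ : Fin r → Fin d → Fin m),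
        (U θ).card + (1 - if ∀ a, t a ∈ U θ then 1 else 0 : ℝ) ≤
        ((Finset.univ.image fun i => (Fin.snoc θ t : Fin (r + 1) → Fin d → Fin m) i
          ((Fin.snoc (g θ) (pick (U θ) t) : Fin (r + 1) → Fin d) i)).card : ℝ) := by
      intro t θ
      have : (Finset.univ.image fun i => (Fin.snoc θ t : Fin (r + 1) → Fin d → Fin m) i
          ((Fin.snoc (g θ) (pick (U θ) t) : Fin (r + 1) → Fin d) i)) =
          insert (t (pick (U θ) t)) (U θ) := by
        ext j
        simp [U, Fin.exists_fin_succ', eq_comm, or_comm]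
      rw [this]
      split_ifs with h
      · rw [Finset.insert_eq_of_mem (h _)]
        simp
      · push Not at h
        rw [Finset.card_insert_of_notMem (hpick _ _ h)]
        simp
    rw [← (Fin.snocEquiv fun _ : Fin (r + 1) => Fin d → Fin m).sum_comp, Fintype.sum_prod_type_right]
    -- The last player fails only if all `d` listed items are among the at most `r` used ones.
    have hcount : ∀ θ, ∑ t : Fin d → Fin m, (if ∀ a, t a ∈ U θ then 1 else 0 : ℝ) ≤ (r : ℝ) ^ d := by
      intro θ
      rw [Finset.sum_boole]
      have : (Finset.univ.filter fun t : Fin d → Fin m => ∀ a, t a ∈ U θ) =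
          Fintype.piFinset fun _ => U θ := by
        ext t
        simp
      rw [this, Fintype.card_piFinset_const]
      exact_mod_cast Nat.pow_le_pow_left (hU θ) _
    calc ((m : ℝ) ^ d) ^ (r + 1) *
          ((r + 1 : ℕ) - ∑ i ∈ Finset.range (r + 1), (i : ℝ) ^ d / (m : ℝ) ^ d)
        = (m : ℝ) ^ d * (((m : ℝ) ^ d) ^ r *
            (r - ∑ i ∈ Finset.range r, (i : ℝ) ^ d / (m : ℝ) ^ d)) +
            ((m : ℝ) ^ d) ^ r * ((m : ℝ) ^ d - (r : ℝ) ^ d) := by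
          rw [Finset.sum_range_succ]
          push_cast
          field_simp
          ring
      _ ≤ (m : ℝ) ^ d * ∑ θ, ((U θ).card : ℝ) + ((m : ℝ) ^ d) ^ r * ((m : ℝ) ^ d - (r : ℝ) ^ d) := by
          gcongr
      _ = ∑ θ, ((m : ℝ) ^ d * ((U θ).card : ℝ) + ((m : ℝ) ^ d - (r : ℝ) ^ d)) := by
          rw [Finset.sum_add_distrib, ← Finset.mul_sum]
          simp [mul_sub]
      _ ≤ ∑ θ, ∑ t : Fin d → Fin m,
            ((U θ).card + (1 - if ∀ a, t a ∈ U θ then 1 else 0 : ℝ)) := by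
          refine Finset.sum_le_sum fun θ _ => ?_
          rw [Finset.sum_add_distrib, Finset.sum_sub_distrib]
          have := hcount θ
          simp only [Finset.sum_const, Finset.card_univ, Fintype.card_fun, Fintype.card_fin,
            nsmul_eq_mul, mul_one, Nat.cast_pow]
          linarith
      _ ≤ _ := by
          refine Finset.sum_le_sum fun θ _ => Finset.sum_le_sum fun t _ => ?_
          simpa [Fin.snocEquiv] using himage t θ

theorem uniform_mem_stdSimplex (K : Type*) [Fintype K] [Nonempty K] :
    (fun _ => 1 / (Fintype.card K : ℝ)) ∈ stdSimplex ℝ K :=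
  ⟨fun _ => by positivity, by simp⟩

/-- A uniformly random list of `d` items contains each of the `m` items with probability at most
`d / m`. -/
theorem sum_uniform_mul_indicator_le {m d : ℕ} (hm : 0 < m) (a : (Fin d → Fin m) → Fin d)
    (j : Fin m) :
    ∑ t : Fin d → Fin m, 1 / (Fintype.card (Fin d → Fin m) : ℝ) *
      Set.indicator {j} 1 (t (a t)) ≤ d / m := by
  classical
  -- Swapping items shows that each list position is uniform; a union bound over the `d` positions
  -- then suffices.
  have hcount : ∀ b : Fin d, (m : ℝ) * ∑ t : Fin d → Fin m, Set.indicator {j} 1 (t b) =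
      (m : ℝ) ^ d := by
    intro b
    have hswap : ∀ j', ∑ t : Fin d → Fin m, Set.indicator {j'} (1 : Fin m → ℝ) (t b) =
        ∑ t : Fin d → Fin m, Set.indicator {j} (1 : Fin m → ℝ) (t b) := by
      intro j'
      refine Fintype.sum_equiv (Equiv.arrowCongr (Equiv.refl _) (Equiv.swap j' j)) _ _ fun t => ?_
      simp [Set.indicator_apply, Equiv.swap_apply_eq_iff]
    calc (m : ℝ) * ∑ t : Fin d → Fin m, Set.indicator {j} 1 (t b)
        = ∑ j' : Fin m, ∑ t : Fin d → Fin m, Set.indicator {j'} (1 : Fin m → ℝ) (t b) := by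
          simp only [hswap, Finset.sum_const, Finset.card_univ, Fintype.card_fin, nsmul_eq_mul]
      _ = _ := by
          rw [Finset.sum_comm]
          simp [Set.indicator_apply]
  have hm' : (0 : ℝ) < m := by exact_mod_cast hm
  rw [← Finset.mul_sum, Fintype.card_fun, Fintype.card_fin, Fintype.card_fin, Nat.cast_pow,
    div_mul_eq_mul_div, one_mul, div_le_div_iff₀ (by positivity) hm']
  calc (∑ t : Fin d → Fin m, Set.indicator {j} (1 : Fin m → ℝ) (t (a t))) * m
      ≤ (∑ t : Fin d → Fin m, ∑ b, Set.indicator {j} (1 : Fin m → ℝ) (t b)) * m := by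
        gcongr with t
        exact Finset.single_le_sum (f := fun b => Set.indicator {j} (1 : Fin m → ℝ) (t b))
          (fun b _ => Set.indicator_nonneg (by simp) _) (Finset.mem_univ (a t))
    _ = ∑ b : Fin d, (m : ℝ) * ∑ t : Fin d → Fin m, Set.indicator {j} 1 (t b) := by
        rw [Finset.sum_comm, ← Finset.mul_sum, mul_comm]
    _ = _ := by
        simp only [hcount, Finset.sum_const, Finset.card_univ, Fintype.card_fin, nsmul_eq_mul]

end Independent

namespace BayesianGame

theorem exists_isIndependent_le_optWelfare_and_welfare_le {m d : ℕ} (hd : 0 < d) (hdm : d < m) :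
    ∃ G : BayesianGame.{0, 0} m, G.IsBasicUtilityGame ∧ G.IsIndependent ∧
      m * (1 - 1 / (d + 1 : ℝ)) ≤ G.optWelfare ∧
      ∀ s : G.StrategyProfile, G.welfare s ≤ m * (1 - Real.exp (-(1 / (1 - d / m : ℝ)))) := by
  have hm : 0 < m := hd.trans hdm
  have hm' : (0 : ℝ) < m := by exact_mod_cast hm
  have := Fin.pos_iff_nonempty.1 hm
  have := Fin.pos_iff_nonempty.1 hd
  let T := Fin d → Fin m
  let μ : T → ℝ := fun _ => 1 / (Fintype.card T : ℝ)
  have hμ : μ ∈ stdSimplex ℝ T := uniform_mem_stdSimplex T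
  let ρ : (Fin m → T) → ℝ := fun θ => ∏ i, μ (θ i)
  have hρ : ρ ∈ stdSimplex ℝ (Fin m → T) := by
    refine ⟨fun θ => Finset.prod_nonneg fun i _ => hμ.1 (θ i), ?_⟩
    rw [← Fintype.prod_sum fun (_ : Fin m) t => μ t]
    simp [hμ.2]
  let G := coverageGame (fun _ : Fin m => T) (fun _ _ => Fin d) ρ hρ fun _ t a => t a
  refine ⟨G, coverageGame_isBasicUtilityGame _ _ _ _ _, ⟨fun _ => μ, fun _ => hμ, fun _ => rfl⟩,
    ?_, fun s => ?_⟩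
  · obtain ⟨g, hg⟩ := exists_matching hm hd m
    refine le_trans ?_ (expect_le_optWelfare (G := G) g)
    have hcard : ∀ θ : Fin m → T, (G.SW fun i => ⟨θ i, g θ i⟩) =
        ((Finset.univ.image fun i => θ i (g θ i)).card : ℝ) := by
      intro θ
      rw [← Set.ncard_coe_finset, Finset.coe_image, Finset.coe_univ, Set.image_univ]
      rfl
    have hρθ : ∀ θ, G.ρ θ = 1 / ((m : ℝ) ^ d) ^ m := by
      intro θ
      simp [G, coverageGame, ρ, μ, T]
    have hsum : ∑ i ∈ Finset.range m, (i : ℝ) ^ d / (m : ℝ) ^ d ≤ m / (d + 1) := by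
      rw [← Finset.sum_div, div_le_div_iff₀ (by positivity) (by positivity), mul_comm]
      have := mul_sum_range_pow_le m d
      rw [pow_succ'] at this
      exact_mod_cast this
    calc (m : ℝ) * (1 - 1 / (d + 1)) = m - m / (d + 1) := by ring
      _ ≤ m - ∑ i ∈ Finset.range m, (i : ℝ) ^ d / (m : ℝ) ^ d := by linarith
      _ ≤ 1 / ((m : ℝ) ^ d) ^ m * ∑ θ : Fin m → T,
            ((Finset.univ.image fun i => θ i (g θ i)).card : ℝ) := by
          rw [div_mul_eq_mul_div, one_mul, le_div_iff₀ (by positivity), mul_comm]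
          exact hg
      _ = _ := by
          rw [Finset.mul_sum]
          refine Finset.sum_congr rfl fun θ _ => ?_
          rw [← hcard θ, ← hρθ θ]
  · have h := sum_prod_mul_ncard_range_le (I := Fin m) (M := Fin m) rfl (fun _ => hμ)
      (fun i t => t (s i t)) (δ := d / m) (by rw [div_lt_one hm']; exact_mod_cast hdm)
      fun i j => sum_uniform_mul_indicator_le hm (s i) j
    rw [Fintype.card_fin] at h
    exact h

theorem exists_isIndependent_PoS_SFCCE_le_add {ε : ℝ} (hε : 0 < ε) :
    ∃ (n : ℕ) (G : BayesianGame.{0, 0} n), G.IsBasicUtilityGame ∧ G.IsIndependent ∧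
      0 < G.optWelfare ∧ G.PoS G.SFCCE ≤ 1 - 1 / Real.exp 1 + ε := by
  -- With m = d² and x = d/m = 1/d, positivity of `φ x` is the required bound. At x = 0 its value is
  -- `ε`, so a large `d` works.
  let φ : ℝ → ℝ := fun x =>
    (1 - 1 / Real.exp 1 + ε) * (1 - x) - (1 - Real.exp (-(1 / (1 - x))))
  have hφ : ContinuousAt φ 0 := by
    have : (1 - 0 : ℝ) ≠ 0 := by norm_num
    fun_prop (disch := assumption)
  have hφ0 : 0 < φ 0 := by
    simpa [φ, Real.exp_neg] using hε
  have hev := (tendsto_one_div_atTop_nhds_zero_nat (𝕜 := ℝ)).eventually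
    (hφ.eventually (lt_mem_nhds hφ0))
  obtain ⟨d, hd, hd2⟩ := (hev.and (Filter.eventually_ge_atTop 2)).exists
  have hd0 : (0 : ℝ) < d := by exact_mod_cast (by omega : 0 < d)
  obtain ⟨G, hG, hI, hO, hw⟩ := exists_isIndependent_le_optWelfare_and_welfare_le (m := d * d) (d := d)
    (by omega) (by nlinarith)
  have hx : ((d : ℝ) / (d * d : ℕ)) = 1 / d := by
    push_cast
    field_simp
  have hm0 : (0 : ℝ) < (d * d : ℕ) := by
    push_cast
    positivity
  have h1 : 1 / (d + 1 : ℝ) ≤ 1 / d := one_div_le_one_div_of_le hd0 (by linarith)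
  have h2 : 0 < 1 - 1 / (d : ℝ) := by
    rw [sub_pos, div_lt_one hd0]
    exact_mod_cast (by omega : 1 < d)
  have hw0 : 0 < ((d * d : ℕ) : ℝ) * (1 - 1 / (d : ℝ)) := mul_pos hm0 h2
  have hO' : ((d * d : ℕ) : ℝ) * (1 - 1 / (d : ℝ)) ≤ G.optWelfare :=
    le_trans (mul_le_mul_of_nonneg_left (by linarith) hm0.le) hO
  refine ⟨_, G, hG, hI, hw0.trans_le hO', PoS_SFCCE_le_of_welfare hw0 hO' fun s => ?_⟩
  refine (hw s).trans ?_
  rw [hx, mul_left_comm]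
  exact mul_le_mul_of_nonneg_left (by linarith [hd]) hm0.le

end BayesianGame

/-! ### Tightness for correlated priors. -/

namespace BayesianGame

section Pushforward

variable {Ω K : Type*} [Fintype Ω] [Fintype K] [DecidableEq K]

/-- The distribution of a function of a uniformly random element. -/
noncomputable def uniformMap (T : Ω → K) (k : K) : ℝ :=
  ∑ ω, if T ω = k then 1 / (Fintype.card Ω : ℝ) else 0

theorem sum_uniformMap_mul (T : Ω → K) (g : K → ℝ) :
    ∑ k, uniformMap T k * g k = ∑ ω, 1 / (Fintype.card Ω : ℝ) * g (T ω) := by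
  simp only [uniformMap, Finset.sum_mul]
  rw [Finset.sum_comm]
  simp

theorem uniformMap_mem_stdSimplex [Nonempty Ω] (T : Ω → K) :
    uniformMap T ∈ stdSimplex ℝ K := by
  refine ⟨fun k => Finset.sum_nonneg fun ω _ => by positivity, ?_⟩
  simpa using sum_uniformMap_mul T 1

end Pushforward

section Permutation

variable {k n : ℕ}

/-- The items that player `i` sees: the common items and one private item, in random order. -/
def visibleItems (π : Equiv.Perm (Fin k ⊕ Fin n)) (i : Fin n) : Finset (Fin k ⊕ Fin n) :=
  insert (π (Sum.inr i)) (Finset.univ.image fun j => π (Sum.inl j))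

theorem visibleItems_mul_swap (π : Equiv.Perm (Fin k ⊕ Fin n)) (i : Fin n) (j : Fin k) :
    visibleItems (π * Equiv.swap (Sum.inr i) (Sum.inl j)) i = visibleItems π i := by
  ext x
  simp only [visibleItems, Finset.mem_insert, Finset.mem_image, Finset.mem_univ, true_and,
    Equiv.Perm.mul_apply, Equiv.swap_apply_left]
  have h : ∀ l, l ≠ j → Equiv.swap (Sum.inr i) (Sum.inl j) (Sum.inl l) = (Sum.inl l : Fin k ⊕ Fin n) :=
    fun l hl => Equiv.swap_apply_of_ne_of_ne (by simp) (by simpa using hl)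
  constructor
  · rintro (rfl | ⟨l, rfl⟩)
    · exact Or.inr ⟨j, rfl⟩
    · by_cases hl : l = j
      · subst hl
        simp
      · exact Or.inr ⟨l, by rw [h l hl]⟩
  · rintro (rfl | ⟨l, rfl⟩)
    · exact Or.inr ⟨j, by simp⟩
    · by_cases hl : l = j
      · subst hl
        exact Or.inl rfl
      · exact Or.inr ⟨l, by rw [h l hl]⟩

/-- A player cannot tell the private item from the common ones. -/
theorem card_private_mul_le (i : Fin n) (c : Finset (Fin k ⊕ Fin n) → Fin k ⊕ Fin n) :
    (k + 1) * (∑ π : Equiv.Perm (Fin k ⊕ Fin n),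
      if c (visibleItems π i) = π (Sum.inr i) then 1 else 0 : ℝ) ≤
      Fintype.card (Equiv.Perm (Fin k ⊕ Fin n)) := by
  set S : ℝ := ∑ π : Equiv.Perm (Fin k ⊕ Fin n),
    if c (visibleItems π i) = π (Sum.inr i) then 1 else 0
  -- Exchanging the private item with a common one keeps what the player sees, so all k + 1 guesses
  -- are correct equally often, and at most one is correct for each `π`.
  have hj : ∀ j : Fin k, (∑ π : Equiv.Perm (Fin k ⊕ Fin n),
      if c (visibleItems π i) = π (Sum.inl j) then 1 else 0 : ℝ) = S := by
    intro j
    refine Fintype.sum_equiv (Equiv.mulRight (Equiv.swap (Sum.inr i) (Sum.inl j))) _ _ fun π => ?_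
    simp [visibleItems_mul_swap]
  calc (k + 1) * S = ∑ _j : Fin k, S + ∑ _u : Unit, S := by simp [add_mul]
    _ = ∑ o : Fin k ⊕ Unit, ∑ π : Equiv.Perm (Fin k ⊕ Fin n),
          (if c (visibleItems π i) = π (o.map id fun _ => i) then 1 else 0 : ℝ) := by
        rw [Fintype.sum_sum_type]
        exact congrArg₂ (· + ·) (Finset.sum_congr rfl fun j _ => (hj j).symm) rfl
    _ = ∑ π : Equiv.Perm (Fin k ⊕ Fin n), ∑ o : Fin k ⊕ Unit,
          (if c (visibleItems π i) = π (o.map id fun _ => i) then 1 else 0 : ℝ) :=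
        Finset.sum_comm
    _ ≤ ∑ π : Equiv.Perm (Fin k ⊕ Fin n), 1 := by
        refine Finset.sum_le_sum fun π _ => ?_
        rw [Finset.sum_boole]
        have : (Finset.univ.filter fun o : Fin k ⊕ Unit =>
            c (visibleItems π i) = π (o.map id fun _ => i)).card ≤ 1 := by
          refine Finset.card_le_one.2 fun o ho o' ho' => ?_
          simp only [Finset.mem_filter, Finset.mem_univ, true_and] at ho ho'
          exact Function.injective_id.sumMap (Function.injective_of_subsingleton _)
            (π.injective (ho.symm.trans ho'))
        exact_mod_cast this
    _ = _ := by simp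

/-- Players who miss their private item only reach the `k` common ones. -/
theorem ncard_range_le {π : Equiv.Perm (Fin k ⊕ Fin n)} {x : Fin n → Fin k ⊕ Fin n}
    (hx : ∀ i, x i ∈ visibleItems π i) :
    ((Set.range x).ncard : ℝ) ≤ k + ∑ i, if x i = π (Sum.inr i) then 1 else 0 := by
  have hsub : Set.range x ⊆ ((Finset.univ.image fun j => π (Sum.inl j)) ∪
      (Finset.univ.filter fun i => x i = π (Sum.inr i)).image x : Finset (Fin k ⊕ Fin n)) := by
    rintro _ ⟨i, rfl⟩
    rw [Finset.coe_union]
    rcases Finset.mem_insert.1 (hx i) with h | h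
    · exact Or.inr (Finset.mem_image_of_mem x (by simpa using h))
    · exact Or.inl h
  have h := Set.ncard_le_ncard hsub
  rw [Set.ncard_coe_finset] at h
  have h' := h.trans ((Finset.card_union_le _ _).trans
    (Nat.add_le_add Finset.card_image_le Finset.card_image_le))
  rw [Finset.sum_boole]
  simp only [Finset.card_univ, Fintype.card_fin] at h'
  exact_mod_cast h'

end Permutation

theorem exists_le_optWelfare_and_welfare_le (k n : ℕ) :
    ∃ G : BayesianGame.{0, 0} n, G.IsBasicUtilityGame ∧ n ≤ G.optWelfare ∧
      ∀ s : G.StrategyProfile, G.welfare s ≤ k + n / (k + 1 : ℝ) := by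
  classical
  let N := Fin k ⊕ Fin n
  let P := Equiv.Perm N
  let T := {t : Finset N // t.Nonempty}
  have hne : ∀ t : T, Nonempty {x // x ∈ t.1} := fun t => t.2.to_subtype
  let τ : P → Fin n → T := fun π i => ⟨visibleItems π i, Finset.insert_nonempty _ _⟩
  let G := coverageGame (fun _ : Fin n => T) (fun _ t => {x // x ∈ t.1}) (uniformMap τ)
    (uniformMap_mem_stdSimplex τ) fun _ _ x => x.1
  have hexp : ∀ g : G.TypeProfile → ℝ,
      G.expect g = ∑ π : P, 1 / (Fintype.card P : ℝ) * g (τ π) := fun g => sum_uniformMap_mul τ g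
  have hP : (0 : ℝ) < Fintype.card P := by exact_mod_cast Fintype.card_pos
  refine ⟨G, coverageGame_isBasicUtilityGame _ _ _ _ _, ?_, fun s => ?_⟩
  -- The type profile need not determine the permutation. Any permutation producing it serves, since
  -- its private items are distinct and visible to their players.
  · let b : ∀ θ : G.TypeProfile, ∀ i, G.Act i (θ i) := fun θ =>
      if h : ∃ π, τ π = θ then fun i => ⟨h.choose (Sum.inr i), by
        rw [← congrFun h.choose_spec i]
        exact Finset.mem_insert_self _ _⟩
      else fun i => (hne (θ i)).some
    refine le_trans ?_ (expect_le_optWelfare (G := G) b)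
    have hb : ∀ π, (G.SW fun i => ⟨τ π i, b (τ π) i⟩) = n := by
      intro π
      have h : ∃ π', τ π' = τ π := ⟨π, rfl⟩
      have hval : ∀ i, (b (τ π) i).1 = h.choose (Sum.inr i) := fun i =>
        congrArg (fun f : ∀ i, {x // x ∈ (τ π i).1} => (f i).1) (dif_pos h)
      change ((Set.range fun i => (b (τ π) i).1).ncard : ℝ) = n
      simp only [hval]
      change ((Set.range (⇑h.choose ∘ Sum.inr)).ncard : ℝ) = n
      rw [Set.ncard_range_of_injective (h.choose.injective.comp Sum.inr_injective)]
      simp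
    rw [hexp]
    simp only [hb]
    simp [hP.ne']
  · let c : Fin n → Finset N → N := fun i t =>
      if h : t.Nonempty then (s i ⟨t, h⟩).1 else Sum.inr i
    have hc : ∀ π i, c i (visibleItems π i) = (s i (τ π i)).1 := fun π i =>
      dif_pos (Finset.insert_nonempty _ _)
    have hi : ∀ i, (∑ π : P, if c i (visibleItems π i) = π (Sum.inr i) then 1 else 0 : ℝ) ≤
        Fintype.card P / (k + 1 : ℝ) := fun i => by
      rw [le_div_iff₀ (by positivity), mul_comm]
      exact card_private_mul_le i (c i)
    calc G.welfare s = 1 / (Fintype.card P : ℝ) * ∑ π : P,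
          ((Set.range fun i => c i (visibleItems π i)).ncard : ℝ) := by
          rw [welfare, hexp, Finset.mul_sum]
          simp only [hc]
          rfl
      _ ≤ 1 / (Fintype.card P : ℝ) * ∑ π : P, (k + ∑ i,
            if c i (visibleItems π i) = π (Sum.inr i) then 1 else 0 : ℝ) := by
          gcongr with π
          exact ncard_range_le fun i => by
            rw [hc]
            exact (s i (τ π i)).2
      _ = k + 1 / (Fintype.card P : ℝ) * ∑ i, ∑ π : P,
            (if c i (visibleItems π i) = π (Sum.inr i) then 1 else 0 : ℝ) := by
          rw [Finset.sum_add_distrib, mul_add, Finset.sum_comm]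
          congr 1
          rw [Finset.sum_const, Finset.card_univ, nsmul_eq_mul]
          field_simp
      _ ≤ k + 1 / (Fintype.card P : ℝ) * ∑ i : Fin n, Fintype.card P / (k + 1 : ℝ) := by
          gcongr with i
          exact hi i
      _ = _ := by
          rw [Finset.sum_const, Finset.card_univ, Fintype.card_fin, nsmul_eq_mul]
          field_simp

/-- For k = ⌊√n⌋ both k and n/(k + 1) are at most √n, while OPT ≥ n. -/
theorem exists_PoS_SFCCE_le_div_sqrt {n : ℕ} (hn : 1 ≤ n) :
    ∃ G : BayesianGame.{0, 0} n, G.IsBasicUtilityGame ∧ 0 < G.optWelfare ∧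
      G.PoS G.SFCCE ≤ 2 / √(n : ℝ) := by
  obtain ⟨G, hG, hO, hw⟩ := exists_le_optWelfare_and_welfare_le n.sqrt n
  have hn0 : (0 : ℝ) < n := by exact_mod_cast hn
  refine ⟨G, hG, hn0.trans_le hO, PoS_SFCCE_le_of_welfare hn0 hO fun s => (hw s).trans ?_⟩
  have h1 : (n.sqrt : ℝ) ≤ √n := Real.nat_sqrt_le_real_sqrt
  have h2 : √(n : ℝ) ≤ n.sqrt + 1 := Real.real_sqrt_le_nat_sqrt_succ
  have h3 : (n : ℝ) / (n.sqrt + 1) ≤ n / √n :=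
    div_le_div_of_nonneg_left hn0.le (Real.sqrt_pos.2 hn0) h2
  have h4 : (n : ℝ) / √n = √n := Real.div_sqrt
  have h5 : 2 / √(n : ℝ) * n = 2 * (n / √n) := by ring
  linarith

end BayesianGame

theorem mainTheorem9 :
    -- the strategic form of a Bayesian basic utility game is a basic utility game
    (∀ (n : ℕ) (G : BayesianGame.{u, v} n), G.IsBasicUtilityGame →
      G.strategicForm.IsBasicUtilityGame) ∧
    -- welfare-maximizing strategy profiles are Bayes–Nash equilibria
    (∀ (n : ℕ) (G : BayesianGame.{u, v} n), G.IsBasicUtilityGame →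
      ∀ s : G.StrategyProfile, (∀ s', G.welfare s' ≤ G.welfare s) →
        G.pointMass s ∈ G.BNE) ∧
    -- the price of stability for Bayes–Nash equilibria is at least the gap
    (∀ (n : ℕ) (G : BayesianGame.{u, v} n), G.IsBasicUtilityGame →
      G.srGap ≤ G.PoS G.BNE) ∧
    -- independent priors
    (∀ (n : ℕ) (G : BayesianGame.{u, v} n), G.IsBasicUtilityGame → G.IsIndependent →
      0 < G.optWelfare → 1 - 1 / Real.exp 1 ≤ G.PoS G.BNE) ∧
    -- correlated priors
    (∃ c : ℝ, 0 < c ∧ ∀ (n : ℕ) (G : BayesianGame.{u, v} n), 1 ≤ n →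
      G.IsBasicUtilityGame → 0 < G.optWelfare → c / √(n : ℝ) ≤ G.PoS G.BNE) ∧
    -- in any Bayesian game, the gap bounds the price of stability from above, even for SFCCEs
    (∀ (n : ℕ) (G : BayesianGame.{u, v} n),
      G.PoS G.BNE ≤ G.PoS G.SFCCE ∧ G.PoS G.SFCCE ≤ G.srGap) ∧
    -- tightness for independent priors, even for SFCCEs
    (∀ ε : ℝ, 0 < ε → ∃ (n : ℕ) (G : BayesianGame.{0, 0} n), G.IsBasicUtilityGame ∧
      G.IsIndependent ∧ 0 < G.optWelfare ∧ G.PoS G.SFCCE ≤ 1 - 1 / Real.exp 1 + ε) ∧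
    -- tightness up to a constant for correlated priors, even for SFCCEs
    (∃ C : ℝ, 0 < C ∧ ∀ n : ℕ, 1 ≤ n → ∃ G : BayesianGame.{0, 0} n, G.IsBasicUtilityGame ∧
      0 < G.optWelfare ∧ G.PoS G.SFCCE ≤ C / √(n : ℝ)) := by
  open BayesianGame in
  exact ⟨fun _ G hG => G.strategicForm_isBasicUtilityGame hG,
    fun _ _ hG _ hs => pointMass_mem_BNE_of_isMax hG hs,
    fun _ _ hG => srGap_le_PoS_BNE hG,
    fun _ _ hG hI hO => one_sub_inv_exp_le_PoS_BNE hG hI hO,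
    ⟨1 / 6, by norm_num, fun _ _ hn hG hO => one_div_sqrt_le_PoS_BNE hn hG hO⟩,
    fun _ G => ⟨G.PoS_BNE_le_PoS_SFCCE, G.PoS_SFCCE_le_srGap⟩,
    fun _ hε => exists_isIndependent_PoS_SFCCE_le_add hε,
    ⟨2, two_pos, fun _ hn => exists_PoS_SFCCE_le_div_sqrt hn⟩⟩
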